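/- Let $\Gamma$ be a finite simple graph with vertex set $V$, $|V|=n$. The link of a clique $\sigma$ is the set of vertices outside $\sigma$ that are adjacent to every vertex of $\sigma$. Assume that $\Gamma$ is link-regular (the number of vertices in the link of a clique depends only on the number of vertices of the clique), that it has no $4$-cliques, that every vertex has degree $l$, and that the link of every edge has $q$ vertices. Let $$C_\Gamma=\langle V \mid v^2=1\ (v\in V),\ uv=vu\ (\{u,v\}\text{ an edge})\rangle$$ be the right-angled Coxeter group of $\Gamma$. A word $w\in V^*$ is geodesic if no shorter word represents the same element of $C_\Gamma$. Let $\mathcal G(z)=\sum_{i\ge 0}\#\{w\in V^i : w \text{ geodesic}\}\,z^i\in\mathbb Z[[z]]$ be the geodesic growth series, and for a word $w$ let $E_w(z)\in\mathbb Z[[z]]$ be the generating series, by length, of the set of geodesic words that end in $w$ (have $w$ as a suffix). Put $$S_v=\sum_{a\in V}E_a(z),\quad S_e=\sum_{\substack{(a,b)\in V^2\\ \{a,b\}\text{ an edge}}}E_{ab}(z),\quad S_\Delta=\sum_{\substack{(a,b,c)\in V^3\\ \{a,b,c\}\text{ a 3-clique}}}E_{abc}(z),\quad S_4=\sum_{(a,b,c,d)\in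 V^4}E_{abcd}(z),$$ where the sums are over ordered tuples, and let $$\begin{aligned} p_\Delta(z,n,l,q)&=1-(n+l-2q-3)z+\bigl(2(n-l-1)(l-q-1)-l(n-2l+q)\bigr)z^2,\\ p_e(n,l,q)&=n^2+l^2-2q^2+nl-2nq-2lq-4n-6l+10q+7,\\ p_v(n,l,q)&=(n-l-1)^3+2l(n-2l+q)(n-q-2)+lq(n-3l+3q). \end{aligned}$$ Then $$\begin{aligned} S_v&=\mathcal G(z)-1, &(1)\\ S_e&=[\mathcal G(z)-1]\,(1-(n-l-1)z)-nz, &(2)\\ S_\Delta&=[\mathcal G(z)-1]\,p_\Delta(z,n,l,q)-nz+n(l-2q-2)z^2, &(3)\\ S_4&=[\mathcal G(z)-1]-nz-n(n-1)z^2-[n(n-1)(n-2)+n(n-l-1)]z^3, &(4)\\ S_4&=(n+l+q-6)\,z\,S_\Delta+p_e(n,l,q)\,z^2S_e+p_v(n,l,q)\,z^3S_v. &(5) \end{aligned}$$ Moreover, these relations determine $\mathcal G(z)$: the equation obtained by substituting the right-hand sides of (1)–(4) into (5), with $\mathcal G(z)$ replaced by an unknown $F\in\mathbb Z[[z]]$,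 has $F=\mathcal G(z)$ as its one and only solution. -/

import Mathlib

open scoped PowerSeries Polynomial

/-- The link of a set of vertices `σ`: the vertices outside `σ` that span a clique together
with `σ`. It is only used for cliques `σ`. -/
def SimpleGraph.link {V : Type*} (Γ : SimpleGraph V) (σ : Finset V) : Set V :=
  {v | v ∉ σ ∧ Γ.IsClique (insert v (σ : Set V))}

/-- A graph is link-regular if the number of vertices in the link of a clique depends only on
the number of vertices of the clique. -/
def SimpleGraph.LinkRegular {V : Type*} (Γ : SimpleGraph V) : Prop :=
  ∀ σ τ : Finset V, Γ.IsClique (σ : Set V) → Γ.IsClique (τ : Set V) →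
    σ.card = τ.card → (Γ.link σ).ncard = (Γ.link τ).ncard

namespace RACG

/-- The formal variable `z` of the power series ring `ℤ⟦z⟧`. -/
noncomputable abbrev z : ℤ⟦X⟧ := PowerSeries.X

/-- The relators `v²` for all vertices `v` and `u v u⁻¹ v⁻¹` for all edges `{u, v}`. -/
def relators {V : Type*} (Γ : SimpleGraph V) : Set (FreeGroup V) :=
  {r | ∃ v : V, r = FreeGroup.of v * FreeGroup.of v} ∪
  {r | ∃ u v : V, Γ.Adj u v ∧
    r = FreeGroup.of u * FreeGroup.of v * (FreeGroup.of u)⁻¹ * (FreeGroup.of v)⁻¹}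

/-- The right-angled Coxeter group
`C_Γ = ⟨V ∣ v² = 1 for all vertices v, u v = v u for all edges {u, v}⟩`. -/
abbrev Grp {V : Type*} (Γ : SimpleGraph V) : Type _ := PresentedGroup (relators Γ)

/-- The element of `C_Γ` represented by a word in the standard generators. -/
def eval {V : Type*} (Γ : SimpleGraph V) (w : List V) : Grp Γ :=
  (w.map fun v => (PresentedGroup.of v : Grp Γ)).prod

/-- A word is geodesic if no word representing the same element is shorter. -/
def IsGeodesic {V : Type*} (Γ : SimpleGraph V) (w : List V) : Prop :=
  ∀ u : List V, eval Γ u = eval Γ w → w.length ≤ u.length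

/-- The generating series `∑ᵢ #(L ∩ Vⁱ) zⁱ` of a language `L` over a finite alphabet. -/
noncomputable def genSeries {V : Type*} (L : Set (List V)) : ℤ⟦X⟧ :=
  PowerSeries.mk fun i => ((L ∩ {u | u.length = i}).ncard : ℤ)

/-- The geodesic growth series of `C_Γ` with respect to the standard generators. -/
noncomputable def geodesicGrowth {V : Type*} (Γ : SimpleGraph V) : ℤ⟦X⟧ :=
  genSeries {u | IsGeodesic Γ u}

/-- The generating series of the set of geodesics ending in `w`, i.e. having the word `w` as a
suffix. -/
noncomputable def E {V : Type*} (Γ : SimpleGraph V) (w : List V) : ℤ⟦X⟧ :=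
  genSeries {u | IsGeodesic Γ u ∧ w <:+ u}

/-- The sum of `E_{ab}` over all ordered pairs `(a, b)` that span an edge. -/
noncomputable def edgeSum {V : Type*} [Fintype V] [DecidableEq V] (Γ : SimpleGraph V)
    [DecidableRel Γ.Adj] : ℤ⟦X⟧ :=
  ∑ a : V, ∑ b : V, if Γ.Adj a b then E Γ [a, b] else 0

/-- The sum of `E_{abc}` over all ordered triples `(a, b, c)` that span a triangle. -/
noncomputable def triangleSum {V : Type*} [Fintype V] [DecidableEq V] (Γ : SimpleGraph V)
    [DecidableRel Γ.Adj] : ℤ⟦X⟧ :=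
  ∑ a : V, ∑ b : V, ∑ c : V, if Γ.IsNClique 3 {a, b, c} then E Γ [a, b, c] else 0

/-- The polynomial `p_Δ(z, n, l, q)`, as a polynomial in `z`. -/
noncomputable def pDelta (n l q : ℤ) : ℤ[X] :=
  1 - Polynomial.C (n + l - 2 * q - 3) * Polynomial.X
    + Polynomial.C (2 * (n - l - 1) * (l - q - 1) - l * (n - 2 * l + q)) * Polynomial.X ^ 2

/-- The polynomial `p_e(n, l, q)`. -/
def pEdge (n l q : ℤ) : ℤ :=
  n ^ 2 + l ^ 2 - 2 * q ^ 2 + n * l - 2 * n * q - 2 * l * q - 4 * n - 6 * l + 10 * q + 7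

/-- The polynomial `p_v(n, l, q)`. -/
def pVertex (n l q : ℤ) : ℤ :=
  (n - l - 1) ^ 3 + 2 * l * (n - 2 * l + q) * (n - q - 2) + l * q * (n - 3 * l + 3 * q)

end RACG

/-! Let D(w) be the set of letters that commutations can bring to the front of w (`descents`). It is
a clique, and D(aw) = {a} ∪ (D(w) ∩ N(a)). The word aw is geodesic exactly when w is and a ∉ D(w)
(`isGeodesic_iff_reduced`). Reversal preserves geodesics, so prescribed suffixes become prefixes and
geodesics can be counted by prepending letters.

Let M_j be the series of non-empty reduced words weighted by |D(w)|^j (`moment`). Prepending a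
letter expresses M_j through sums over b ∉ D of powers of |D ∩ N(b)|, which double counting
evaluates from l and q (`sum_card_adj`, `sum_card_adj_sq`). The equation for M_2 produces |D|³.
Without 4-cliques |D| is 1, 2 or 3, so the cube reduces to lower powers (`card_descents_cubic`) and
M_0, M_1, M_2 satisfy a closed linear system.

All the sums in question are combinations of these moments, up to words of length at most three. The
equations for M_0 and M_1 give the edge and triangle relations; the one for M_2 gives the last
relation. After substitution the unknown F has a coefficient with constant term 1, hence uniqueness.
-/

namespace RACG

/-! ### Words, evaluation and reversal. -/

section Words

variable {V : Type*} (Γ : SimpleGraph V)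

lemma eval_cons (a : V) (w : List V) :
    eval Γ (a :: w) = (PresentedGroup.of a : Grp Γ) * eval Γ w := by
  simp [eval]

lemma not_mem_of_adj {u v : V} (h : Γ.Adj u v) {e : Sym2 V} (hu : u ∈ e ∧ e ∉ Γ.edgeSet) :
    ¬ (v ∈ e ∧ e ∉ Γ.edgeSet) := fun hv => by
  have := (Sym2.mem_and_mem_iff h.ne).1 ⟨hu.1, hv.1⟩
  subst this
  exact hu.2 h

lemma of_mul_of_self (v : V) :
    (PresentedGroup.of v : Grp Γ) * PresentedGroup.of v = 1 :=
  PresentedGroup.one_of_mem (rels := relators Γ) (Or.inl ⟨v, rfl⟩)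

lemma of_mul_of_comm {u v : V} (h : Γ.Adj u v) :
    (PresentedGroup.of u : Grp Γ) * PresentedGroup.of v =
      PresentedGroup.of v * PresentedGroup.of u := by
  have : (PresentedGroup.of u : Grp Γ) * PresentedGroup.of v * (PresentedGroup.of u)⁻¹ *
      (PresentedGroup.of v)⁻¹ = 1 :=
    PresentedGroup.one_of_mem (rels := relators Γ) (Or.inr ⟨u, v, h, rfl⟩)
  rwa [mul_inv_eq_one, mul_inv_eq_iff_eq_mul] at this

lemma eval_reverse (w : List V) : eval Γ w.reverse = (eval Γ w)⁻¹ := by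
  induction w with
  | nil => simp [eval]
  | cons a w ih =>
    have : eval Γ (w.reverse ++ [a]) = eval Γ w.reverse * PresentedGroup.of a := by simp [eval]
    rw [List.reverse_cons, this, ih, eval_cons, mul_inv_rev,
      inv_eq_of_mul_eq_one_left (of_mul_of_self Γ a)]

lemma isGeodesic_reverse (w : List V) : IsGeodesic Γ w.reverse ↔ IsGeodesic Γ w := by
  suffices ∀ w : List V, IsGeodesic Γ w → IsGeodesic Γ w.reverse from
    ⟨fun h => by simpa using this _ h, this w⟩
  intro w hw u hu
  have := hw u.reverse (by rw [eval_reverse, hu, eval_reverse, inv_inv])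
  simpa using this

end Words

/-! ### An action of the group that detects length. -/

section Action

variable {V : Type*} [DecidableEq V] (Γ : SimpleGraph V)

/-- The non-edges (loops included) that contain `v`. -/
abbrev NonEdgeAt (v : V) : Type _ := {e : Sym2 V // v ∈ e ∧ e ∉ Γ.edgeSet}

instance (v : V) : Nonempty (NonEdgeAt Γ v) := ⟨⟨s(v, v), by simp⟩⟩

/-- The number of letters `v` that can be split off at the front of a family of words indexed by
the non-edges. -/
noncomputable def lead (v : V) (P : Sym2 V → List V) : ℕ :=
  ⨅ e : NonEdgeAt Γ v, ((P e.1).takeWhile (· = v)).length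

open Classical in
/-- The action of the generator `v` on families of words indexed by the non-edges: it adds or
removes a leading letter `v`, according to the parity of `lead`. -/
noncomputable def toggle (v : V) (P : Sym2 V → List V) : Sym2 V → List V := fun e =>
  if v ∈ e ∧ e ∉ Γ.edgeSet then (if Even (lead Γ v P) then v :: P e else (P e).tail) else P e

lemma lead_add_one {v : V} {P Q : Sym2 V → List V}
    (h : ∀ e : NonEdgeAt Γ v, Q e.1 = v :: P e.1) : lead Γ v Q = lead Γ v P + 1 := by
  have hQ : ∀ e : NonEdgeAt Γ v, ((Q e.1).takeWhile (· = v)).length =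
      ((P e.1).takeWhile (· = v)).length + 1 := fun e => by simp [h e]
  unfold lead
  simp only [hQ]
  apply le_antisymm
  · obtain ⟨e, he⟩ := Nat.sInf_mem
      (Set.range_nonempty fun e : NonEdgeAt Γ v => ((P e.1).takeWhile (· = v)).length)
    rw [iInf, iInf, ← he]
    exact Nat.sInf_le ⟨e, rfl⟩
  · refine le_ciInf fun e => Nat.succ_le_succ (ciInf_le (OrderBot.bddBelow _) e)

lemma eq_cons_of_lead_ne_zero {v : V} {P : Sym2 V → List V} (h : lead Γ v P ≠ 0)
    (e : NonEdgeAt Γ v) : P e.1 = v :: (P e.1).tail := by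
  have h1 : lead Γ v P ≤ ((P e.1).takeWhile (· = v)).length :=
    ciInf_le (OrderBot.bddBelow _) e
  cases hP : P e.1 with
  | nil => simp [hP] at h1; omega
  | cons a w =>
    by_cases ha : a = v
    · simp [ha]
    · simp [hP, ha] at h1; omega

lemma lead_eq_zero {v : V} {P : Sym2 V → List V} (e : NonEdgeAt Γ v)
    (h : (P e.1).head? ≠ some v) : lead Γ v P = 0 := by
  by_contra h0
  rw [eq_cons_of_lead_ne_zero Γ h0 e] at h
  simp at h

/-- Adding or removing v changes `lead` by one and so flips its parity. The parity rule makes this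
an involution on all families, with no consistency condition on them. -/
lemma toggle_toggle (v : V) (P : Sym2 V → List V) : toggle Γ v (toggle Γ v P) = P := by
  by_cases h : Even (lead Γ v P)
  · have h1 : lead Γ v (toggle Γ v P) = lead Γ v P + 1 :=
      lead_add_one Γ fun e => by simp [toggle, e.2.1, e.2.2, h]
    have h2 : ¬ Even (lead Γ v (toggle Γ v P)) := by rw [h1]; simpa [Nat.even_add_one] using h
    funext e
    by_cases he : v ∈ e ∧ e ∉ Γ.edgeSet
    · rw [toggle, if_pos he, if_neg h2, toggle, if_pos he, if_pos h, List.tail_cons]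
    · rw [toggle, if_neg he, toggle, if_neg he]
  · have h0 : lead Γ v P ≠ 0 := by rintro h0; simp [h0] at h
    have h1 : lead Γ v P = lead Γ v (toggle Γ v P) + 1 :=
      lead_add_one Γ fun e => by
        rw [eq_cons_of_lead_ne_zero Γ h0 e]
        simp [toggle, e.2.1, e.2.2, h]
    have h2 : Even (lead Γ v (toggle Γ v P)) := by
      rw [h1, Nat.even_add_one, not_not] at h; exact h
    funext e
    by_cases he : v ∈ e ∧ e ∉ Γ.edgeSet
    · rw [toggle, if_pos he, if_pos h2, toggle, if_pos he, if_neg h]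
      exact (eq_cons_of_lead_ne_zero Γ h0 ⟨e, he⟩).symm
    · rw [toggle, if_neg he, toggle, if_neg he]

lemma lead_toggle_of_adj {u v : V} (h : Γ.Adj u v) (P : Sym2 V → List V) :
    lead Γ v (toggle Γ u P) = lead Γ v P := by
  unfold lead
  congr! 4 with e
  rw [toggle, if_neg (not_mem_of_adj Γ h.symm e.2)]

/-- No non-edge contains both ends of an edge, so the two generators act on disjoint sets of
coordinates and neither changes the other's `lead`. -/
lemma toggle_comm {u v : V} (h : Γ.Adj u v) (P : Sym2 V → List V) :
    toggle Γ u (toggle Γ v P) = toggle Γ v (toggle Γ u P) := by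
  funext e
  by_cases hu : u ∈ e ∧ e ∉ Γ.edgeSet
  · have hv := not_mem_of_adj Γ h hu
    rw [toggle, if_pos hu, lead_toggle_of_adj Γ h.symm, toggle, if_neg hv, toggle, if_neg hv,
      toggle, if_pos hu]
  · by_cases hv : v ∈ e ∧ e ∉ Γ.edgeSet
    · rw [toggle, if_neg hu, toggle, if_pos hv, toggle, if_pos hv, lead_toggle_of_adj Γ h,
        toggle, if_neg hu]
    · rw [toggle, if_neg hu, toggle, if_neg hv, toggle, if_neg hv, toggle, if_neg hu]

/-- The action of the right-angled Coxeter group on families of words indexed by the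
non-edges. -/
noncomputable def toggleHom : Grp Γ →* Equiv.Perm (Sym2 V → List V) :=
  PresentedGroup.toGroup (f := fun v => (show Function.Involutive (toggle Γ v) from
    toggle_toggle Γ v).toPerm) <| by
    rintro r (⟨v, rfl⟩ | ⟨u, v, h, rfl⟩)
    · ext1 P
      simpa using toggle_toggle Γ v P
    · simp only [map_mul, map_inv, FreeGroup.lift_apply_of]
      rw [mul_inv_eq_one, mul_inv_eq_iff_eq_mul]
      ext1 P
      simpa using toggle_comm Γ h P

lemma toggleHom_eval (w : List V) (P : Sym2 V → List V) :
    toggleHom Γ (eval Γ w) P = w.foldr (toggle Γ) P := by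
  induction w with
  | nil => simp [eval]
  | cons a w ih =>
    rw [eval_cons, map_mul, Equiv.Perm.mul_apply, ih]
    simp [toggleHom]

lemma toggle_diag_of_ne {u v : V} (h : u ≠ v) (P : Sym2 V → List V) :
    toggle Γ v P s(u, u) = P s(u, u) := by
  simp [toggle, h.symm]

/-- The number of letters of a family of words. -/
def size [Fintype V] (P : Sym2 V → List V) : ℕ := ∑ v : V, (P s(v, v)).length

lemma size_toggle_le [Fintype V] (v : V) (P : Sym2 V → List V) :
    size (toggle Γ v P) ≤ size P + 1 := by
  unfold size
  rw [← Finset.add_sum_erase _ _ (Finset.mem_univ v),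
    ← Finset.add_sum_erase (a := v) _ (fun v => (P s(v, v)).length) (Finset.mem_univ v),
    Finset.sum_congr rfl fun u hu => by rw [toggle_diag_of_ne Γ (Finset.ne_of_mem_erase hu)]]
  have : (toggle Γ v P s(v, v)).length ≤ (P s(v, v)).length + 1 := by
    unfold toggle
    split_ifs <;> (simp; try omega)
  omega

lemma size_toggle_of_even [Fintype V] (v : V) (P : Sym2 V → List V) (h : Even (lead Γ v P)) :
    size (toggle Γ v P) = size P + 1 := by
  unfold size
  rw [← Finset.add_sum_erase _ _ (Finset.mem_univ v),
    ← Finset.add_sum_erase (a := v) _ (fun v => (P s(v, v)).length) (Finset.mem_univ v),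
    Finset.sum_congr rfl fun u hu => by rw [toggle_diag_of_ne Γ (Finset.ne_of_mem_erase hu)]]
  have : (toggle Γ v P s(v, v)).length = (P s(v, v)).length + 1 := by
    simp [toggle, h]
  omega

end Action

/-! ### Geodesic words are the reduced words. -/

section Geodesics

variable {V : Type*} [DecidableEq V] (Γ : SimpleGraph V) [DecidableRel Γ.Adj]

/-- The letters that can be moved to the front of a word by commutations. -/
def descents : List V → Finset V
  | [] => ∅
  | a :: w => insert a ((descents w).filter (Γ.Adj a))

/-- The words in which no two occurrences of a letter can be cancelled after commutations. -/
def Reduced : List V → Prop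
  | [] => True
  | a :: w => a ∉ descents Γ w ∧ Reduced w

lemma isClique_descents (w : List V) : Γ.IsClique (descents Γ w : Set V) := by
  induction w with
  | nil => simp [descents]
  | cons a w ih =>
    rw [descents, Finset.coe_insert, SimpleGraph.isClique_insert]
    exact ⟨ih.subset (Finset.coe_subset.2 (Finset.filter_subset _ _)),
      fun b hb _ => (Finset.mem_filter.1 hb).2⟩

lemma card_descents_cons (a : V) (w : List V) :
    (descents Γ (a :: w)).card = ((descents Γ w).filter (Γ.Adj a)).card + 1 := by
  rw [descents, Finset.card_insert_of_notMem (by simp)]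

lemma card_descents_cubic (hfree : Γ.CliqueFree 4) (v : V) (w : List V) :
    ((descents Γ (v :: w)).card : ℤ) ^ 3 =
      6 * (descents Γ (v :: w)).card ^ 2 - 11 * (descents Γ (v :: w)).card + 6 := by
  have h1 : (descents Γ (v :: w)).card < 4 := by
    by_contra! h
    exact hfree.mono h _ ⟨isClique_descents Γ _, rfl⟩
  have h2 : 0 < (descents Γ (v :: w)).card := by simp [card_descents_cons]
  interval_cases (descents Γ (v :: w)).card <;> norm_num

/-- One coordinate at v whose word does not start with v suffices. With this, reading a reduced word
from right to left always adds a letter and never removes one. -/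
lemma lead_foldr_eq_zero {w : List V} (hw : Reduced Γ w) {v : V} (hv : v ∉ descents Γ w) :
    lead Γ v (w.foldr (toggle Γ) fun _ => []) = 0 := by
  suffices ∀ v ∉ descents Γ w, ∃ e : NonEdgeAt Γ v,
      ((w.foldr (toggle Γ) fun _ => []) e.1).head? ≠ some v from
    (this v hv).elim fun e => lead_eq_zero Γ e
  clear hv v
  induction w with
  | nil => exact fun v _ => ⟨⟨s(v, v), by simp⟩, by simp⟩
  | cons a w ih =>
    intro v hv
    have h0 : lead Γ a (w.foldr (toggle Γ) fun _ => []) = 0 :=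
      (ih hw.2 a hw.1).elim fun e => lead_eq_zero Γ e
    simp only [descents, Finset.mem_insert, Finset.mem_filter, not_or, not_and] at hv
    by_cases hav : Γ.Adj a v
    · obtain ⟨e, he⟩ := ih hw.2 v fun h => hv.2 h hav
      refine ⟨e, ?_⟩
      rwa [List.foldr_cons, toggle, if_neg (not_mem_of_adj Γ hav.symm e.2)]
    -- As a and v do not commute, {v, a} is a coordinate that a acts on; its word now starts with a
    -- ≠ v.
    · refine ⟨⟨s(v, a), by simp, by simpa [Γ.adj_comm] using hav⟩, ?_⟩
      rw [List.foldr_cons, toggle, if_pos ⟨by simp, by simpa [Γ.adj_comm] using hav⟩,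
        if_pos (by rw [h0]; exact Even.zero)]
      simpa using Ne.symm hv.1

lemma size_foldr_of_reduced [Fintype V] {w : List V} (hw : Reduced Γ w) :
    size (w.foldr (toggle Γ) fun _ => []) = w.length := by
  induction w with
  | nil => simp [size]
  | cons a w ih =>
    rw [List.foldr_cons, size_toggle_of_even, ih hw.2, List.length_cons]
    rw [lead_foldr_eq_zero Γ hw.2 hw.1]
    exact Even.zero

lemma exists_eval_of_mem_descents {a : V} {w : List V} (h : a ∈ descents Γ w) :
    ∃ u : List V, u.length + 1 = w.length ∧
      eval Γ w = (PresentedGroup.of a : Grp Γ) * eval Γ u := by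
  induction w with
  | nil => simp [descents] at h
  | cons b w ih =>
    simp only [descents, Finset.mem_insert, Finset.mem_filter] at h
    rcases h with rfl | ⟨h, hab⟩
    · exact ⟨w, rfl, eval_cons Γ _ _⟩
    · obtain ⟨u, hu, he⟩ := ih h
      refine ⟨b :: u, by simp [hu], ?_⟩
      rw [eval_cons, eval_cons, he, ← mul_assoc, ← mul_assoc, of_mul_of_comm Γ hab]

lemma isGeodesic_iff_reduced [Fintype V] (w : List V) : IsGeodesic Γ w ↔ Reduced Γ w := by
  refine ⟨fun hw => ?_, fun hw u hu => ?_⟩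
  · induction w with
    | nil => trivial
    | cons a w ih =>
      refine ⟨fun ha => ?_, ih fun u hu => ?_⟩
      · obtain ⟨u, hl, hu⟩ := exists_eval_of_mem_descents Γ ha
        have := hw u (by rw [eval_cons, hu, ← mul_assoc, of_mul_of_self, one_mul])
        simp at this
        omega
      · have := hw (a :: u) (by rw [eval_cons, eval_cons, hu])
        simpa using this
  -- The size of the resulting family depends only on the group element: it is the length of the
  -- reduced word, and at most the length of any other representative.
  · rw [← size_foldr_of_reduced Γ hw, ← toggleHom_eval, ← hu, toggleHom_eval]
    clear hu
    induction u with
    | nil => simp [size]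
    | cons a u ih => exact (size_toggle_le Γ _ _).trans (Nat.succ_le_succ ih)

end Geodesics

/-! ### Generating series as weighted sums over reduced words. -/

section Counting

variable {V : Type*} [Fintype V] [DecidableEq V] (Γ : SimpleGraph V) [DecidableRel Γ.Adj]

/-- The reduced words of a given length. -/
def redWords : ℕ → Finset (List V)
  | 0 => {[]}
  | k + 1 => (redWords k).biUnion fun w => (descents Γ w)ᶜ.image (· :: w)

lemma mem_redWords {k : ℕ} {w : List V} : w ∈ redWords Γ k ↔ Reduced Γ w ∧ w.length = k := by
  induction k generalizing w with
  | zero =>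
    simp only [redWords, Finset.mem_singleton, List.length_eq_zero_iff]
    exact ⟨fun h => ⟨h ▸ trivial, h⟩, And.right⟩
  | succ k ih =>
    cases w with
    | nil => simp [redWords]
    | cons a w =>
      simp [redWords, ih, Reduced]
      tauto

lemma sum_redWords_succ (k : ℕ) (f : List V → ℤ) :
    ∑ w ∈ redWords Γ (k + 1), f w =
      ∑ w ∈ redWords Γ k, ∑ a ∈ (descents Γ w)ᶜ, f (a :: w) := by
  rw [redWords, Finset.sum_biUnion]
  · refine Finset.sum_congr rfl fun w _ => Finset.sum_image fun a _ b _ h => ?_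
    simpa using h
  · intro u _ w _ huw
    refine Finset.disjoint_left.2 fun x hx hx' => huw ?_
    obtain ⟨a, _, rfl⟩ := Finset.mem_image.1 hx
    obtain ⟨b, _, h⟩ := Finset.mem_image.1 hx'
    simp only [List.cons.injEq] at h
    exact h.2.symm

/-- The generating series of the reduced words, weighted by a function. -/
noncomputable def wsum : (List V → ℤ) →ₗ[ℤ] ℤ⟦X⟧ where
  toFun f := PowerSeries.mk fun k => ∑ w ∈ redWords Γ k, f w
  map_add' f g := by ext k; simp [Finset.sum_add_distrib]
  map_smul' c f := by
    ext k
    rw [PowerSeries.coeff_mk, RingHom.id_apply, zsmul_eq_mul (PowerSeries.mk _),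
      ← eq_intCast (PowerSeries.C (R := ℤ)), PowerSeries.coeff_C_mul, PowerSeries.coeff_mk]
    simp [Finset.mul_sum]

lemma coeff_wsum (f : List V → ℤ) (k : ℕ) :
    PowerSeries.coeff k (wsum Γ f) = ∑ w ∈ redWords Γ k, f w := by
  simp [wsum]

/-- Splitting off the first letter of the non-empty words. -/
lemma wsum_eq (f : List V → ℤ) :
    wsum Γ f = (f [] : ℤ⟦X⟧) + z * wsum Γ fun w => ∑ a ∈ (descents Γ w)ᶜ, f (a :: w) := by
  ext k
  cases k with
  | zero => simp [coeff_wsum, redWords]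
  | succ k =>
    rw [map_add, PowerSeries.coeff_succ_X_mul, coeff_wsum, coeff_wsum, sum_redWords_succ,
      ← eq_intCast (PowerSeries.C (R := ℤ)), PowerSeries.coeff_C, if_neg k.succ_ne_zero, zero_add]

lemma wsum_prefix (u : List V) (p : List V → Prop) [DecidablePred p]
    (hp : ∀ w, p w ↔ u <+: w) : E Γ u.reverse = wsum Γ fun w => if p w then 1 else 0 := by
  ext k
  rw [coeff_wsum, E, genSeries, PowerSeries.coeff_mk, Finset.sum_boole, ← Set.ncard_coe_finset,
    ← Set.ncard_image_of_injective _ (List.reverse_injective (α := V))]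
  congr! 2
  ext w
  simp only [Set.mem_image, Set.mem_inter_iff, Set.mem_ofPred_eq, Finset.coe_filter, mem_redWords,
    hp]
  constructor
  · rintro ⟨x, ⟨⟨h1, h2⟩, h3⟩, rfl⟩
    refine ⟨⟨?_, by simpa using h3⟩, ?_⟩
    · rwa [← isGeodesic_iff_reduced, isGeodesic_reverse]
    · rwa [← List.reverse_suffix, List.reverse_reverse]
  · rintro ⟨⟨h1, h2⟩, h3⟩
    refine ⟨w.reverse, ⟨⟨?_, ?_⟩, by simpa using h2⟩, by simp⟩
    · rwa [isGeodesic_reverse, isGeodesic_iff_reduced]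
    · rwa [List.reverse_suffix]

lemma geodesicGrowth_eq : geodesicGrowth Γ = wsum Γ fun _ => 1 := by
  have := wsum_prefix Γ [] (fun _ => True) (by simp)
  simpa [E, geodesicGrowth] using this

lemma sum_E : ∑ a : V, E Γ [a] = wsum Γ fun w => if w = [] then 0 else 1 := by
  have h (a : V) := wsum_prefix Γ [a] ([a] <+: ·) (by simp)
  simp only [List.reverse_singleton] at h
  simp only [h, ← map_sum]
  congr 1
  ext w
  rcases w with _ | ⟨a, w⟩ <;> simp [List.cons_prefix_cons]

lemma edgeSum_eq : edgeSum Γ = wsum Γ fun w => match w with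
    | b :: a :: _ => if Γ.Adj a b then 1 else 0
    | _ => 0 := by
  have h (a b : V) := wsum_prefix Γ [b, a] ([b, a] <+: ·) (by simp)
  simp only [List.reverse_cons, List.reverse_nil, List.nil_append, List.singleton_append] at h
  have h' (a b : V) : (if Γ.Adj a b then E Γ [a, b] else 0) =
      wsum Γ fun w => if [b, a] <+: w ∧ Γ.Adj a b then 1 else 0 := by
    split_ifs with hab
    · simp [h, hab]
    · simp only [hab, and_false, if_false]
      exact (map_zero (wsum Γ)).symm
  simp only [edgeSum, h', ← map_sum]
  congr 1
  ext w
  rcases w with _ | ⟨b, _ | ⟨a, w⟩⟩ <;>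
    simp [List.cons_prefix_cons, ite_and]

lemma triangleSum_eq : triangleSum Γ = wsum Γ fun w => match w with
    | c :: b :: a :: _ => if Γ.Adj a b ∧ Γ.Adj a c ∧ Γ.Adj b c then 1 else 0
    | _ => 0 := by
  have h (a b c : V) := wsum_prefix Γ [c, b, a] ([c, b, a] <+: ·) (by simp)
  simp only [List.reverse_cons, List.reverse_nil, List.nil_append,
    List.cons_append] at h
  have h' (a b c : V) : (if Γ.IsNClique 3 {a, b, c} then E Γ [a, b, c] else 0) =
      wsum Γ fun w => if [c, b, a] <+: w ∧ Γ.Adj a b ∧ Γ.Adj a c ∧ Γ.Adj b c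
        then 1 else 0 := by
    simp only [SimpleGraph.is3Clique_triple_iff]
    split_ifs with hab
    · simp [h, hab]
    · simp only [hab, and_false, if_false]
      exact (map_zero (wsum Γ)).symm
  simp only [triangleSum, h', ← map_sum]
  congr 1
  ext w
  rcases w with _ | ⟨c, _ | ⟨b, _ | ⟨a, w⟩⟩⟩ <;>
    simp [List.cons_prefix_cons, ite_and]

lemma sum_E_four : ∑ a : V, ∑ b : V, ∑ c : V, ∑ d : V, E Γ [a, b, c, d] =
    wsum Γ fun w => if 4 ≤ w.length then 1 else 0 := by
  have h (a b c d : V) := wsum_prefix Γ [d, c, b, a] ([d, c, b, a] <+: ·) (by simp)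
  simp only [List.reverse_cons, List.reverse_nil, List.nil_append,
    List.cons_append] at h
  simp only [h, ← map_sum]
  congr 1
  ext w
  rcases w with _ | ⟨d, _ | ⟨c, _ | ⟨b, _ | ⟨a, w⟩⟩⟩⟩ <;>
    simp [List.cons_prefix_cons, ite_and]

end Counting

/-! ### Double counting around a clique. -/

section Cliques

variable {V : Type*} [Fintype V] [DecidableEq V] {Γ : SimpleGraph V} [DecidableRel Γ.Adj]
  {l q : ℕ} {T : Finset V}

lemma card_adj_compl (hl : Γ.IsRegularOfDegree l) (hT : Γ.IsClique (T : Set V)) {a : V}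
    (ha : a ∈ T) : ((Tᶜ.filter (Γ.Adj a)).card : ℤ) = l - T.card + 1 := by
  have h1 : Tᶜ.filter (Γ.Adj a) = Γ.neighborFinset a \ T.erase a := by
    ext b
    have : b = a → ¬ Γ.Adj a b := by rintro rfl; simp
    simp
    tauto
  have h2 : T.erase a ⊆ Γ.neighborFinset a := fun b hb => by
    rw [Finset.mem_erase] at hb
    simpa using hT ha hb.2 hb.1.symm
  rw [h1, Finset.cast_card_sdiff h2, Finset.cast_card_erase_of_mem ha,
    SimpleGraph.card_neighborFinset_eq_degree, hl a]
  ring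

lemma card_adj_adj_compl (hq : ∀ a b : V, Γ.Adj a b → (Γ.link {a, b}).ncard = q)
    (hT : Γ.IsClique (T : Set V)) {a b : V} (ha : a ∈ T) (hb : b ∈ T) (hab : a ≠ b) :
    ((Tᶜ.filter fun c => Γ.Adj a c ∧ Γ.Adj b c).card : ℤ) = q - T.card + 2 := by
  have hadj := hT ha hb hab
  have h0 : Γ.link {a, b} = (Finset.univ.filter fun c => Γ.Adj a c ∧ Γ.Adj b c : Finset V) := by
    ext c
    have h1 : c = a → ¬ Γ.Adj a c := by rintro rfl; simp
    have h2 : c = b → ¬ Γ.Adj b c := by rintro rfl; simp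
    simp [SimpleGraph.link, SimpleGraph.isClique_insert, Γ.adj_comm c]
    tauto
  have h1 : Tᶜ.filter (fun c => Γ.Adj a c ∧ Γ.Adj b c) =
      (Finset.univ.filter fun c => Γ.Adj a c ∧ Γ.Adj b c) \ (T.erase a).erase b := by
    ext c
    have h1 : c = a → ¬ Γ.Adj a c := by rintro rfl; simp
    have h2 : c = b → ¬ Γ.Adj b c := by rintro rfl; simp
    simp
    tauto
  have h2 : (T.erase a).erase b ⊆ Finset.univ.filter fun c => Γ.Adj a c ∧ Γ.Adj b c :=
    fun c hc => by
      simp only [Finset.mem_erase] at hc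
      simpa using ⟨hT ha hc.2.2 hc.2.1.symm, hT hb hc.2.2 hc.1.symm⟩
  rw [h1, Finset.cast_card_sdiff h2,
    Finset.cast_card_erase_of_mem (Finset.mem_erase.2 ⟨hab.symm, hb⟩),
    Finset.cast_card_erase_of_mem ha, ← Set.ncard_coe_finset, ← h0, hq a b hadj]
  ring

/-- Exchange the summations: c = a contributes the neighbours of a outside T, and each other c ∈ T
the common neighbours of a and c outside T. -/
lemma sum_adj_card_adj (hl : Γ.IsRegularOfDegree l)
    (hq : ∀ a b : V, Γ.Adj a b → (Γ.link {a, b}).ncard = q)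
    (hT : Γ.IsClique (T : Set V)) {a : V} (ha : a ∈ T) :
    ∑ b ∈ Tᶜ.filter (Γ.Adj a), ((T.filter (Γ.Adj b)).card : ℤ) =
      (l - T.card + 1) + (T.card - 1) * (q - T.card + 2) := by
  have h : ∀ b, ((T.filter (Γ.Adj b)).card : ℤ) = ∑ c ∈ T, if Γ.Adj c b then 1 else 0 := by
    intro b
    rw [Finset.sum_boole]
    simp only [Γ.adj_comm b]
  simp only [h]
  rw [Finset.sum_comm, ← Finset.add_sum_erase _ _ ha]
  simp only [Finset.sum_boole, Finset.filter_filter]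
  congr 1
  · simpa using card_adj_compl hl hT ha
  · rw [Finset.sum_congr rfl fun b hb => card_adj_adj_compl hq hT ha (Finset.mem_of_mem_erase hb)
      (Finset.ne_of_mem_erase hb).symm, Finset.sum_const, nsmul_eq_mul,
      Finset.cast_card_erase_of_mem ha]

/-- Double counting of the edges between a clique and its complement. -/
lemma sum_mul_card_adj (T : Finset V) (g : V → ℤ) :
    ∑ b ∈ Tᶜ, g b * ((T.filter (Γ.Adj b)).card : ℤ) =
      ∑ a ∈ T, ∑ b ∈ Tᶜ.filter (Γ.Adj a), g b := by
  simp only [Finset.card_filter, Nat.cast_sum, Finset.mul_sum, Finset.sum_filter]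
  rw [Finset.sum_comm]
  simp [Γ.adj_comm]

lemma sum_card_adj (hl : Γ.IsRegularOfDegree l) (hT : Γ.IsClique (T : Set V)) :
    ∑ b ∈ Tᶜ, ((T.filter (Γ.Adj b)).card : ℤ) = T.card * (l - T.card + 1) := by
  have := sum_mul_card_adj (Γ := Γ) T fun _ => 1
  simp only [one_mul, Finset.sum_const, nsmul_eq_mul, mul_one] at this
  rw [this, Finset.sum_congr rfl fun a ha => card_adj_compl hl hT ha]
  simp

lemma sum_card_adj_sq (hl : Γ.IsRegularOfDegree l)
    (hq : ∀ a b : V, Γ.Adj a b → (Γ.link {a, b}).ncard = q) (hT : Γ.IsClique (T : Set V)) :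
    ∑ b ∈ Tᶜ, ((T.filter (Γ.Adj b)).card : ℤ) ^ 2 =
      T.card * ((l - T.card + 1) + (T.card - 1) * (q - T.card + 2)) := by
  simp only [pow_two]
  rw [sum_mul_card_adj, Finset.sum_congr rfl fun a ha => sum_adj_card_adj hl hq hT ha]
  simp

end Cliques

/-! ### Linear equations between the moments. -/

section Moments

variable {V : Type*} [Fintype V] [DecidableEq V] (Γ : SimpleGraph V) [DecidableRel Γ.Adj]

lemma wsum_shift {f g : List V → ℤ} (h0 : f [] = 0)
    (h : ∀ w, ∑ b ∈ (descents Γ w)ᶜ, f (b :: w) = g w) : wsum Γ f = z * wsum Γ g := by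
  rw [wsum_eq, h0, Int.cast_zero, zero_add, funext h]

lemma wsum_nil : wsum Γ (fun w => if w = [] then 1 else 0) = 1 := by
  rw [wsum_eq]
  simp only [List.cons_ne_nil, if_false, Finset.sum_const_zero, if_true, Int.cast_one]
  rw [show (fun _ => 0 : List V → ℤ) = 0 from rfl, map_zero, mul_zero, add_zero]

/-- The generating series of the non-empty reduced words, weighted by a power of the number of
descents. -/
noncomputable def moment (j : ℕ) : ℤ⟦X⟧ :=
  wsum Γ fun w => if w = [] then 0 else ((descents Γ w).card : ℤ) ^ j

/-- The empty word is kept apart because it has no descents, and the cubic relation fails at 0. -/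
lemma wsum_eq_moments {f : List V → ℤ} (e a b c : ℤ) (h0 : f [] = e)
    (h : ∀ v w, f (v :: w) = a + b * (descents Γ (v :: w)).card +
      c * (descents Γ (v :: w)).card ^ 2) :
    wsum Γ f = e + a * moment Γ 0 + b * moment Γ 1 + c * moment Γ 2 := by
  have : f = e • (fun w => if w = [] then 1 else 0) +
      a • (fun w => if w = [] then 0 else ((descents Γ w).card : ℤ) ^ 0) +
      b • (fun w => if w = [] then 0 else ((descents Γ w).card : ℤ) ^ 1) +
      c • (fun w => if w = [] then 0 else ((descents Γ w).card : ℤ) ^ 2) := by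
    ext w
    rcases w with _ | ⟨v, w⟩ <;> simp [h0, h]
  rw [this]
  simp only [map_add, map_smul, wsum_nil, moment]
  simp only [zsmul_eq_mul, mul_one]

lemma geodesicGrowth_eq_moment : geodesicGrowth Γ = 1 + moment Γ 0 := by
  rw [geodesicGrowth_eq, wsum_eq_moments Γ 1 1 0 0 rfl (by simp)]
  simp

lemma sum_E_eq_moment : ∑ a : V, E Γ [a] = moment Γ 0 := by
  rw [sum_E, wsum_eq_moments Γ 0 1 0 0 rfl (by simp)]
  simp

variable {Γ} {l q : ℕ}

lemma moment_zero_eq : moment Γ 0 =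
    z * (Fintype.card V + Fintype.card V * moment Γ 0 - moment Γ 1) := by
  refine (wsum_shift Γ (g := fun w => Fintype.card V - (descents Γ w).card) rfl ?_).trans ?_
  · intro w
    simp [Finset.card_compl, Nat.cast_sub (Finset.card_le_univ _)]
  · rw [wsum_eq_moments Γ (Fintype.card V) (Fintype.card V) (-1) 0]
    · push_cast; ring
    · simp [descents]
    · intro v w; ring

lemma moment_one_eq (hl : Γ.IsRegularOfDegree l) : moment Γ 1 =
    z * (Fintype.card V + Fintype.card V * moment Γ 0 + l * moment Γ 1 - moment Γ 2) := by
  refine (wsum_shift Γ (g := fun w => Fintype.card V - (descents Γ w).card +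
      (descents Γ w).card * (l - (descents Γ w).card + 1)) rfl ?_).trans ?_
  · intro w
    simp only [List.cons_ne_nil, if_false, card_descents_cons, pow_one, Nat.cast_add,
      Nat.cast_one, Finset.sum_add_distrib, sum_card_adj hl (isClique_descents Γ w)]
    simp [Finset.card_compl, Nat.cast_sub (Finset.card_le_univ _)]
    ring
  · rw [wsum_eq_moments Γ (Fintype.card V) (Fintype.card V) l (-1)]
    · push_cast; ring
    · simp [descents]
    · intro v w; ring

lemma moment_two_eq (hfree : Γ.CliqueFree 4) (hl : Γ.IsRegularOfDegree l)
    (hq : ∀ a b : V, Γ.Adj a b → (Γ.link {a, b}).ncard = q) : moment Γ 2 =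
    z * (Fintype.card V + (Fintype.card V - 6) * moment Γ 0 + (3 * l - q + 11) * moment Γ 1 +
      (q - 6) * moment Γ 2) := by
  refine (wsum_shift Γ (g := fun w => Fintype.card V - (descents Γ w).card +
      2 * ((descents Γ w).card * (l - (descents Γ w).card + 1)) +
      (descents Γ w).card * ((l - (descents Γ w).card + 1) +
        ((descents Γ w).card - 1) * (q - (descents Γ w).card + 2))) rfl ?_).trans ?_
  · intro w
    have h (b : V) : ((((descents Γ w).filter (Γ.Adj b)).card + 1 : ℕ) : ℤ) ^ 2 =
        1 + 2 * ((descents Γ w).filter (Γ.Adj b)).card +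
          (((descents Γ w).filter (Γ.Adj b)).card : ℤ) ^ 2 := by push_cast; ring
    simp only [List.cons_ne_nil, if_false, card_descents_cons, h, Finset.sum_add_distrib,
      ← Finset.mul_sum, sum_card_adj hl (isClique_descents Γ w),
      sum_card_adj_sq hl hq (isClique_descents Γ w)]
    simp [Finset.card_compl, Nat.cast_sub (Finset.card_le_univ _)]
  · rw [wsum_eq_moments Γ (Fintype.card V) (Fintype.card V - 6) (3 * l - q + 11) (q - 6)]
    · push_cast; ring
    · simp [descents]
    · intro v w
      -- The weight is n + (3l - q)d + qd² - d³ with d the number of descents; replacing d³ yields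
      -- the shifts by 6 and 11.
      linear_combination -card_descents_cubic Γ hfree v w

lemma edgeSum_eq_moments (hl : Γ.IsRegularOfDegree l) :
    edgeSum Γ = z * ((l + 1) * moment Γ 0 - moment Γ 1) := by
  rw [edgeSum_eq, wsum_shift Γ (g := fun w => if w = [] then 0 else
      l - (descents Γ w).card + 1) rfl, wsum_eq_moments Γ 0 (l + 1) (-1) 0]
  · push_cast; ring
  · simp
  · intro v w; simp; ring
  · rintro (_ | ⟨a, w⟩)
    · simp
    · have h := card_adj_compl hl (isClique_descents Γ (a :: w)) (a := a) (by simp [descents])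
      simpa using h

lemma triangleSum_eq_moments (hl : Γ.IsRegularOfDegree l)
    (hq : ∀ a b : V, Γ.Adj a b → (Γ.link {a, b}).ncard = q) :
    triangleSum Γ = z ^ 2 * ((q * (l + 1) + q + 2) * moment Γ 0 - (2 * q + 3) * moment Γ 1 +
      moment Γ 2) := by
  -- Two letters are split off: the first shift counts the choices of c before ba, the second sums
  -- over the neighbours b of a.
  rw [triangleSum_eq, wsum_shift Γ (g := fun w => match w with
      | b :: a :: w => if Γ.Adj a b then q - (descents Γ (b :: a :: w)).card + 2 else 0
      | _ => 0) rfl,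
    wsum_shift Γ (g := fun w => if w = [] then 0 else
      (l - (descents Γ w).card + 1) * q - ((descents Γ w).card - 1) *
        (q - (descents Γ w).card + 2)) rfl,
    wsum_eq_moments Γ 0 (q * (l + 1) + q + 2) (-(2 * q + 3)) 1]
  · push_cast; ring
  · simp
  · intro v w; simp; ring
  · rintro (_ | ⟨a, w⟩)
    · simp
    · have ha : a ∈ descents Γ (a :: w) := by simp [descents]
      have h1 := card_adj_compl hl (isClique_descents Γ (a :: w)) ha
      have h2 := sum_adj_card_adj hl hq (isClique_descents Γ (a :: w)) ha
      have h (b : V) : (q : ℤ) - ((((descents Γ (a :: w)).filter (Γ.Adj b)).card + 1 : ℕ) : ℤ) + 2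
          = (q + 1) - ((descents Γ (a :: w)).filter (Γ.Adj b)).card := by push_cast; ring
      simp only [List.cons_ne_nil, if_false, card_descents_cons _ _ (a :: w), h,
        ← Finset.sum_filter, Finset.sum_sub_distrib, h2, Finset.sum_const, nsmul_eq_mul, h1]
      ring
  · rintro (_ | ⟨b, _ | ⟨a, w⟩⟩)
    · simp
    · simp
    · by_cases hab : Γ.Adj a b
      · have h := card_adj_adj_compl hq (isClique_descents Γ (b :: a :: w)) (a := a) (b := b)
        simp only [hab, true_and, if_true, Finset.sum_boole]
        -- Since a commutes with b, it is still a descent after b is prepended.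
        by_cases ha : a ∈ descents Γ (b :: a :: w)
        · exact h ha (by simp [descents]) hab.ne
        · simp [descents, hab.symm] at ha
      · simp [hab]

lemma sum_E_four_eq_moments (hl : Γ.IsRegularOfDegree l) :
    ∑ a : V, ∑ b : V, ∑ c : V, ∑ d : V, E Γ [a, b, c, d] =
      moment Γ 0 - Fintype.card V * z - Fintype.card V * (Fintype.card V - 1) * z ^ 2 -
        Fintype.card V * ((Fintype.card V - 1) ^ 2 - l) * z ^ 3 := by
  set n := Fintype.card V with hn
  have hcard (w : List V) : ((descents Γ w)ᶜ.card : ℤ) = n - (descents Γ w).card := by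
    simp [Finset.card_compl, Nat.cast_sub (Finset.card_le_univ _), hn]
  let len (k : ℕ) : List V → ℤ := fun w => if w.length = k then 1 else 0
  have h1 : wsum Γ (len 1) = n * z := by
    rw [wsum_shift Γ (g := (n : ℤ) • fun w => if w = [] then 1 else 0) rfl, map_smul, wsum_nil,
      zsmul_eq_mul]
    · push_cast; ring
    · rintro (_ | ⟨a, w⟩) <;> simp [len, descents, hn]
  have h2 : wsum Γ (len 2) = n * (n - 1) * z ^ 2 := by
    rw [wsum_shift Γ (g := (n - 1 : ℤ) • len 1) rfl, map_smul, h1, zsmul_eq_mul]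
    · push_cast; ring
    · rintro (_ | ⟨a, _ | ⟨b, w⟩⟩)
      · simp [len]
      · simp [len, hcard]
        simp [descents]
      · simp [len]
  have h3 : wsum Γ (len 3) = n * ((n - 1) ^ 2 - l) * z ^ 3 := by
    rw [wsum_shift Γ (g := fun w => if w.length = 2 then n - (descents Γ w).card else 0) rfl,
      wsum_shift Γ (g := ((n - 1) ^ 2 - l : ℤ) • len 1) rfl, map_smul, h1, zsmul_eq_mul]
    · push_cast; ring
    · rintro (_ | ⟨a, _ | ⟨b, w⟩⟩)
      · simp [len]
      · have h := sum_card_adj hl (isClique_descents Γ [a])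
        have hc : ((descents Γ [a]).card : ℤ) = 1 := by simp [descents]
        simp only [List.length_cons, List.length_nil, card_descents_cons _ _ [a], Nat.cast_add,
          Nat.cast_one, Finset.sum_sub_distrib, Finset.sum_add_distrib, h, Finset.sum_const,
          nsmul_eq_mul, hcard, hc, len, Pi.smul_apply, smul_eq_mul, if_true, zero_add,
          Nat.reduceAdd]
        ring
      · simp [len]
    · intro w
      by_cases hw : w.length = 2 <;> simp [len, hw, hcard]
  have h : (fun w : List V => if 4 ≤ w.length then (1 : ℤ) else 0) =
      (fun w => if w = [] then 0 else ((descents Γ w).card : ℤ) ^ 0) - len 1 - len 2 - len 3 := by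
    ext w
    rcases w with _ | ⟨d, _ | ⟨c, _ | ⟨b, _ | ⟨a, w⟩⟩⟩⟩ <;> simp [len]
  rw [sum_E_four, h, map_sub, map_sub, map_sub, h1, h2, h3, moment]

end Moments

/-! ### Elimination of the moments and uniqueness. -/

lemma coe_pDelta (n l q : ℤ) : (pDelta n l q : ℤ⟦X⟧) = 1 - (n + l - 2 * q - 3 : ℤ⟦X⟧) * z +
    (2 * (n - l - 1) * (l - q - 1) - l * (n - 2 * l + q) : ℤ⟦X⟧) * z ^ 2 := by
  simp only [pDelta, Polynomial.coe_add, Polynomial.coe_sub, Polynomial.coe_mul,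
    Polynomial.coe_one, Polynomial.coe_pow, Polynomial.coe_X, Polynomial.coe_C]
  simp only [eq_intCast]
  push_cast
  ring

end RACG

theorem theorem3p2 {V : Type*} [Fintype V] [DecidableEq V] (Γ : SimpleGraph V)
    [DecidableRel Γ.Adj] (n l q : ℕ)
    (hreg : Γ.LinkRegular) (hfree : Γ.CliqueFree 4)
    (hn : Fintype.card V = n) (hl : Γ.IsRegularOfDegree l)
    (hq : ∀ a b : V, Γ.Adj a b → (Γ.link {a, b}).ncard = q) :
    -- vertices
    (∑ a : V, RACG.E Γ [a] = RACG.geodesicGrowth Γ - 1) ∧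
    -- edges
    (RACG.edgeSum Γ =
      (RACG.geodesicGrowth Γ - 1) * (1 - (n - l - 1) * RACG.z) - n * RACG.z) ∧
    -- triangles
    (RACG.triangleSum Γ =
      (RACG.geodesicGrowth Γ - 1) * (RACG.pDelta n l q : ℤ⟦X⟧)
        - n * RACG.z + n * (l - 2 * q - 2) * RACG.z ^ 2) ∧
    -- words of four letters, by subtraction of the geodesics of length at most three
    (∑ a : V, ∑ b : V, ∑ c : V, ∑ d : V, RACG.E Γ [a, b, c, d] =
      (RACG.geodesicGrowth Γ - 1) - n * RACG.z - n * (n - 1) * RACG.z ^ 2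
        - (n * (n - 1) * (n - 2) + n * (n - l - 1)) * RACG.z ^ 3) ∧
    -- words of four letters, through triangles, edges and vertices
    (∑ a : V, ∑ b : V, ∑ c : V, ∑ d : V, RACG.E Γ [a, b, c, d] =
      (n + l + q - 6) * RACG.z * RACG.triangleSum Γ
        + (RACG.pEdge n l q : ℤ⟦X⟧) * RACG.z ^ 2 * RACG.edgeSum Γ
        + (RACG.pVertex n l q : ℤ⟦X⟧) * RACG.z ^ 3 * ∑ a : V, RACG.E Γ [a]) ∧
    -- the first four relations, substituted into the fifth, determine the growth series
    (∀ F : ℤ⟦X⟧,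
      ((F - 1) - n * RACG.z - n * (n - 1) * RACG.z ^ 2
          - (n * (n - 1) * (n - 2) + n * (n - l - 1)) * RACG.z ^ 3 =
        (n + l + q - 6) * RACG.z *
            ((F - 1) * (RACG.pDelta n l q : ℤ⟦X⟧)
              - n * RACG.z + n * (l - 2 * q - 2) * RACG.z ^ 2)
          + (RACG.pEdge n l q : ℤ⟦X⟧) * RACG.z ^ 2 *
            ((F - 1) * (1 - (n - l - 1) * RACG.z) - n * RACG.z)
          + (RACG.pVertex n l q : ℤ⟦X⟧) * RACG.z ^ 3 * (F - 1)) ↔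
      F = RACG.geodesicGrowth Γ) := by
  
  have e0 := RACG.moment_zero_eq (Γ := Γ)
  have e1 := RACG.moment_one_eq hl
  have e2 := RACG.moment_two_eq hfree hl hq
  have hE := RACG.edgeSum_eq_moments hl
  have hD := RACG.triangleSum_eq_moments hl hq
  have h4 := RACG.sum_E_four_eq_moments hl
  have hG := RACG.geodesicGrowth_eq_moment Γ
  have hV := RACG.sum_E_eq_moment Γ
  have hp := RACG.coe_pDelta n l q
  simp only [Int.cast_natCast] at hp
  rw [hn] at e0 e1 e2 h4
  -- M_1 and M_2 are solved for in terms of M_0, with powers of z kept on the left to avoid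
  -- division.
  have k1 : RACG.z * RACG.moment Γ 1 =
      n * RACG.z + n * RACG.z * RACG.moment Γ 0 - RACG.moment Γ 0 := by
    linear_combination e0
  have k2 : RACG.z ^ 2 * RACG.moment Γ 2 = n * RACG.z ^ 2 + n * RACG.z ^ 2 * RACG.moment Γ 0 +
      (l * RACG.z - 1) * (n * RACG.z + n * RACG.z * RACG.moment Γ 0 - RACG.moment Γ 0) := by
    linear_combination RACG.z * e1 + (l * RACG.z - 1) * k1
  have r2 : RACG.edgeSum Γ =
      (RACG.geodesicGrowth Γ - 1) * (1 - (n - l - 1) * RACG.z) - n * RACG.z := by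
    rw [hE, hG]
    linear_combination -k1
  have r3 : RACG.triangleSum Γ =
      (RACG.geodesicGrowth Γ - 1) * (RACG.pDelta n l q : ℤ⟦X⟧)
        - n * RACG.z + n * (l - 2 * q - 2) * RACG.z ^ 2 := by
    rw [hD, hG, hp]
    linear_combination k2 - (2 * q + 3) * RACG.z * k1
  have r4 : ∑ a : V, ∑ b : V, ∑ c : V, ∑ d : V, RACG.E Γ [a, b, c, d] =
      (RACG.geodesicGrowth Γ - 1) - n * RACG.z - n * (n - 1) * RACG.z ^ 2
        - (n * (n - 1) * (n - 2) + n * (n - l - 1)) * RACG.z ^ 3 := by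
    rw [h4, hG]
    ring
  have r5 : ∑ a : V, ∑ b : V, ∑ c : V, ∑ d : V, RACG.E Γ [a, b, c, d] =
      (n + l + q - 6) * RACG.z * RACG.triangleSum Γ
        + (RACG.pEdge n l q : ℤ⟦X⟧) * RACG.z ^ 2 * RACG.edgeSum Γ
        + (RACG.pVertex n l q : ℤ⟦X⟧) * RACG.z ^ 3 * ∑ a : V, RACG.E Γ [a] := by
    rw [r4, r3, r2, hV, hG, hp]
    simp only [RACG.pEdge, RACG.pVertex]
    push_cast
    linear_combination RACG.z ^ 2 * e2 + ((q - 6) * RACG.z - 1) * k2 +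
      (3 * l - q + 11) * RACG.z ^ 2 * k1
  refine ⟨by rw [hV, hG]; ring, r2, r3, r4, r5, fun F => ⟨fun hF => ?_, ?_⟩⟩
  · have h5 := r5
    rw [r4, r3, r2, hV, show RACG.moment Γ 0 = RACG.geodesicGrowth Γ - 1 by rw [hG]; ring] at h5
    have hu : (F - RACG.geodesicGrowth Γ) * (1 - RACG.z * ((n + l + q - 6) * RACG.pDelta n l q +
        RACG.pEdge n l q * RACG.z * (1 - (n - l - 1) * RACG.z) +
        RACG.pVertex n l q * RACG.z ^ 2)) = 0 := by
      linear_combination hF - h5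
    -- Power series over ℤ form a domain, and the second factor has constant term 1, so it is not
    -- zero.
    rcases mul_eq_zero.1 hu with h | h
    · exact sub_eq_zero.1 h
    · have := congrArg (PowerSeries.constantCoeff (R := ℤ)) h
      simp at this
  · rintro rfl
    rw [← r4, r5, r3, r2, hV, hG]
    ring
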